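/- Let $\mathbb K\in\{\mathbb R,\mathbb C\}$, $1\le p<\infty$, $I\subset\mathbb R^s$, and let $\mu$ be a finite (Borel) measure on $I$. For $\mathbb K$-vector spaces $V,W$ with algebraic tensor product $V\otimes_a W$ and for $r=(r_1,r_2)\in\mathbb N^2$, let $$\mathcal T_r(V\otimes_a W)=\{v\in V\otimes_a W:\ v\in U_1\otimes_a U_2\text{ for some subspaces }U_1\subset V,\ U_2\subset W\text{ with }\dim U_1=r_1,\ \dim U_2=r_2\}$$ be the Tucker set and $\mathcal R_1(V\otimes_a W)=\{x\otimes y: x\in V,\ y\in W\}$ the set of rank-one (elementary) tensors. A subset $M$ of a Banach space is called weakly closed if it is closed in the weak topology; in particular, $v_m\in M$ and $v_m\rightharpoonup v$ imply $v\in M$. (a) For every Banach space $X$ over $\mathbb K$ and every $r\in\mathbb N^2$, the set $\mathcal T_r(X\otimes_a L^p_\mu(I))$ is weakly closed in the Bochner space $L^p_\mu(I;X)$, where $x\otimes f$ is identified with the function $t\mapsto f(t)\,x$. (b) In particular, for every $K\subset\mathbb R^k$, every finite (Borel) measure $\nu$ on $K$ and every $r\in\mathbb N^2$, the sets $\mathcal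 T_r(L^p_\nu(K)\otimes_a L^p_\mu(I))$ and $\mathcal R_1(L^p_\nu(K)\otimes_a L^p_\mu(I))$ are weakly closed in $L^p_{\nu\otimes\mu}(K\times I)$, where $f\otimes g$ is identified with the function $(x,t)\mapsto f(x)g(t)$. -/

import Mathlib

open MeasureTheory Filter
open scoped TensorProduct ENNReal Topology

/-- `M` is weakly closed in the normed space `E`: it is closed in the weak topology, and it contains
the limit of every weakly convergent sequence of its elements. (The first half implies the second;
both are recorded because `weakly closed` is used in either sense.) -/
def IsWeaklyClosed (𝕜 : Type*) [RCLike 𝕜] {E : Type*} [NormedAddCommGroup E] [NormedSpace 𝕜 E]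
    (M : Set E) : Prop :=
  IsClosed (toWeakSpace 𝕜 E '' M) ∧
    ∀ (u : ℕ → E) (v : E), (∀ m, u m ∈ M) →
      (∀ φ : E →L[𝕜] 𝕜, Tendsto (fun m => φ (u m)) atTop (𝓝 (φ v))) → v ∈ M

section Tensor

variable (𝕜 : Type*) [Field 𝕜] (V W : Type*) [AddCommGroup V] [Module 𝕜 V]
  [AddCommGroup W] [Module 𝕜 W]

/-- The Tucker set `T_(r₁,r₂)(V ⊗ W)`: the algebraic tensors lying in `U₁ ⊗ U₂` for some subspaces
`U₁ ⊆ V`, `U₂ ⊆ W` with `dim U₁ = r₁` and `dim U₂ = r₂`. -/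
def tuckerSet (r₁ r₂ : ℕ) : Set (V ⊗[𝕜] W) :=
  {v | ∃ (U₁ : Submodule 𝕜 V) (U₂ : Submodule 𝕜 W),
    Module.rank 𝕜 U₁ = (r₁ : Cardinal) ∧ Module.rank 𝕜 U₂ = (r₂ : Cardinal) ∧
      v ∈ LinearMap.range (TensorProduct.map U₁.subtype U₂.subtype)}

/-- The set `R_1(V ⊗ W)` of elementary tensors. -/
def rankOneSet : Set (V ⊗[𝕜] W) :=
  {v | ∃ (x : V) (y : W), v = x ⊗ₜ[𝕜] y}

end Tensor

noncomputable section Embeddings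

variable (𝕜 : Type*) [RCLike 𝕜] (p : ℝ≥0∞)

/-- The canonical linear map `X ⊗ L^p(μ) → L^p(μ; X)` which sends `x ⊗ f` to the class of
`t ↦ f t • x`; through it algebraic tensors are regarded as `X`-valued functions. -/
def tensorToBochner (X : Type*) [NormedAddCommGroup X] [NormedSpace 𝕜 X]
    {I : Type*} [MeasurableSpace I] (μ : Measure I) :
    X ⊗[𝕜] Lp 𝕜 p μ →ₗ[𝕜] Lp X p μ :=
  TensorProduct.lift
    (LinearMap.mk₂ 𝕜 (fun (x : X) (f : Lp 𝕜 p μ) =>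
        (ContinuousLinearMap.toSpanSingleton 𝕜 x).compLpₗ p μ f)
      (fun x y f => by
        simp only [ContinuousLinearMap.compLpₗ_apply, ContinuousLinearMap.toSpanSingleton_add,
          ContinuousLinearMap.add_compLp])
      (fun c x f => by
        simp only [ContinuousLinearMap.compLpₗ_apply, ContinuousLinearMap.toSpanSingleton_smul,
          ContinuousLinearMap.smul_compLp])
      (fun x f g =>
        map_add ((ContinuousLinearMap.toSpanSingleton 𝕜 x).compLpₗ p μ) f g)
      (fun c x f =>
        map_smul ((ContinuousLinearMap.toSpanSingleton 𝕜 x).compLpₗ p μ) c f))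

theorem tensorToBochner_tmul (X : Type*) [NormedAddCommGroup X] [NormedSpace 𝕜 X]
    {I : Type*} [MeasurableSpace I] (μ : Measure I) (x : X) (f : Lp 𝕜 p μ) :
    tensorToBochner 𝕜 p X μ (x ⊗ₜ[𝕜] f) =ᵐ[μ] fun t => f t • x := by
  have h := (ContinuousLinearMap.toSpanSingleton 𝕜 x).coeFn_compLp' f
  rw [tensorToBochner, TensorProduct.lift.tmul, LinearMap.mk₂_apply,
    ContinuousLinearMap.compLpₗ_apply]
  simpa using h

variable {K I : Type*} [MeasurableSpace K] [MeasurableSpace I]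
  (ν : Measure K) (μ : Measure I) [SFinite μ]

variable {𝕜 p ν μ} in
theorem memLp_mul_prod {f : K → 𝕜} {g : I → 𝕜} (hf : MemLp f p ν) (hg : MemLp g p μ) :
    MemLp (fun z : K × I => f z.1 * g z.2) p (ν.prod μ) := by
  have hm : AEStronglyMeasurable (fun z : K × I => f z.1 * g z.2) (ν.prod μ) :=
    hf.1.comp_fst.mul hg.1.comp_snd
  rcases eq_or_ne p 0 with rfl | h0
  · exact memLp_zero_iff_aestronglyMeasurable.2 hm
  rcases eq_or_ne p ∞ with rfl | ht
  · have h1 := Measure.quasiMeasurePreserving_fst (μ := ν) (ν := μ) |>.ae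
      (ae_le_eLpNormEssSup (f := f) (μ := ν))
    have h2 := Measure.quasiMeasurePreserving_snd (μ := ν) (ν := μ) |>.ae
      (ae_le_eLpNormEssSup (f := g) (μ := μ))
    refine ⟨hm, ?_⟩
    have hf2 := hf.2
    have hg2 := hg.2
    rw [eLpNorm_exponent_top] at hf2 hg2 ⊢
    refine lt_of_le_of_lt (eLpNormEssSup_le_of_ae_enorm_bound ?_) (ENNReal.mul_lt_top hf2 hg2)
    filter_upwards [h1, h2] with z hz1 hz2
    rw [enorm_mul]
    exact mul_le_mul' hz1 hz2
  · refine ⟨hm, ?_⟩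
    have hf2 := lintegral_rpow_enorm_lt_top_of_eLpNorm_lt_top h0 ht hf.2
    have hg2 := lintegral_rpow_enorm_lt_top_of_eLpNorm_lt_top h0 ht hg.2
    rw [eLpNorm_lt_top_iff_lintegral_rpow_enorm_lt_top h0 ht]
    simp_rw [enorm_mul, ENNReal.mul_rpow_of_nonneg _ _ ENNReal.toReal_nonneg]
    rw [lintegral_prod_mul (hf.1.enorm.pow_const _) (hg.1.enorm.pow_const _)]
    exact ENNReal.mul_lt_top hf2 hg2

variable {𝕜 p ν μ} in
/-- The class of `(x, t) ↦ f x * g t` in `L^p(ν ⊗ μ)`. -/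
def lpProdMul (f : Lp 𝕜 p ν) (g : Lp 𝕜 p μ) : Lp 𝕜 p (ν.prod μ) :=
  (memLp_mul_prod (Lp.memLp f) (Lp.memLp g)).toLp (fun z : K × I => f z.1 * g z.2)

variable {𝕜 p ν μ} in
theorem coeFn_lpProdMul (f : Lp 𝕜 p ν) (g : Lp 𝕜 p μ) :
    lpProdMul f g =ᵐ[ν.prod μ] fun z : K × I => f z.1 * g z.2 :=
  MemLp.coeFn_toLp _

/-- The canonical linear map `L^p(ν) ⊗ L^p(μ) → L^p(ν ⊗ μ)` which sends `f ⊗ g` to the class of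
`(x, t) ↦ f x * g t`; through it algebraic tensors are regarded as functions on the product. -/
def tensorToLpProd : Lp 𝕜 p ν ⊗[𝕜] Lp 𝕜 p μ →ₗ[𝕜] Lp 𝕜 p (ν.prod μ) :=
  TensorProduct.lift
    (LinearMap.mk₂ 𝕜 lpProdMul
      (fun f f' g => by
        apply Lp.ext
        filter_upwards [coeFn_lpProdMul (f + f') g, coeFn_lpProdMul f g, coeFn_lpProdMul f' g,
          Lp.coeFn_add (lpProdMul f g) (lpProdMul f' g),
          Measure.quasiMeasurePreserving_fst (μ := ν) (ν := μ) |>.ae (Lp.coeFn_add f f')]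
          with z h1 h2 h3 h4 h5
        rw [h1, h4, Pi.add_apply, h2, h3, h5, Pi.add_apply, add_mul])
      (fun c f g => by
        apply Lp.ext
        filter_upwards [coeFn_lpProdMul (c • f) g, coeFn_lpProdMul f g,
          Lp.coeFn_smul c (lpProdMul f g),
          Measure.quasiMeasurePreserving_fst (μ := ν) (ν := μ) |>.ae (Lp.coeFn_smul c f)]
          with z h1 h2 h3 h4
        rw [h1, h3, Pi.smul_apply, h2, h4, Pi.smul_apply, smul_mul_assoc])
      (fun f g g' => by
        apply Lp.ext
        filter_upwards [coeFn_lpProdMul f (g + g'), coeFn_lpProdMul f g, coeFn_lpProdMul f g',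
          Lp.coeFn_add (lpProdMul f g) (lpProdMul f g'),
          Measure.quasiMeasurePreserving_snd (μ := ν) (ν := μ) |>.ae (Lp.coeFn_add g g')]
          with z h1 h2 h3 h4 h5
        rw [h1, h4, Pi.add_apply, h2, h3, h5, Pi.add_apply, mul_add])
      (fun c f g => by
        apply Lp.ext
        filter_upwards [coeFn_lpProdMul f (c • g), coeFn_lpProdMul f g,
          Lp.coeFn_smul c (lpProdMul f g),
          Measure.quasiMeasurePreserving_snd (μ := ν) (ν := μ) |>.ae (Lp.coeFn_smul c g)]
          with z h1 h2 h3 h4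
        rw [h1, h3, Pi.smul_apply, h2, h4, Pi.smul_apply, mul_smul_comm]))

theorem tensorToLpProd_tmul (f : Lp 𝕜 p ν) (g : Lp 𝕜 p μ) :
    tensorToLpProd 𝕜 p ν μ (f ⊗ₜ[𝕜] g) =ᵐ[ν.prod μ] fun z : K × I => f z.1 * g z.2 := by
  have h := coeFn_lpProdMul f g
  rwa [tensorToLpProd, TensorProduct.lift.tmul, LinearMap.mk₂_apply]

end Embeddings

/-! ### Vanishing minors and skeleton decompositions. -/

section Minors

variable {𝕜 : Type*} [Field 𝕜] {α β : Type*}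

/-! A Tucker set is empty or consists of all sums of `min r₁ r₂` elementary tensors, so it suffices
to treat sums of `r` elementary tensors. Test `F` with functionals that split along elementary
tensors: `φ (∫_A F)` in the Bochner space, `∫_{B × A} F` on the product. The scalar array so
obtained has rank at most `r` for such sums, hence all its `(r + 1)`-minors vanish. Each minor is a
polynomial in finitely many continuous functionals, so this condition is weakly closed, with no
appeal to reflexivity.

Conversely, `exists_skeleton_decomposition` writes an array with vanishing minors through finitely
many of its rows and columns. These are the arrays of genuine elements of the factors: `∫_A F` and
`φ ∘ F`, or the marginals of `F`. As the functionals separate points, `F` is the corresponding sum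
(`isWeaklyClosed_image_sumElementarySet`). -/

theorem Matrix.det_mul_eq_zero_of_card_lt {m n : Type*} [Fintype m] [DecidableEq m] [Fintype n]
    (A : Matrix m n 𝕜) (B : Matrix n m 𝕜) (h : Fintype.card n < Fintype.card m) :
    (A * B).det = 0 := by
  by_contra hdet
  have h1 := Matrix.rank_of_isUnit (A * B) ((Matrix.isUnit_iff_isUnit_det _).2 (Ne.isUnit hdet))
  have h2 := (Matrix.rank_mul_le_left A B).trans (Matrix.rank_le_card_width A)
  omega

/-- The skeleton decomposition of a two-variable array all of whose `(r + 1)`-minors vanish. -/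
theorem exists_skeleton_decomposition (N : α → β → 𝕜) (r : ℕ)
    (hN : ∀ (a : Fin (r + 1) → α) (b : Fin (r + 1) → β),
      (Matrix.of fun i j => N (a i) (b j)).det = 0) :
    ∃ n ≤ r, ∃ (a : Fin n → α) (b : Fin n → β) (C : Matrix (Fin n) (Fin n) 𝕜),
      ∀ x y, N x y = ∑ j, ∑ i, N x (b j) * C j i * N (a i) y := by
  classical
  let P : ℕ → Prop := fun n => ∀ (a : Fin (n + 1) → α) (b : Fin (n + 1) → β),
      (Matrix.of fun i j => N (a i) (b j)).det = 0
  have hP : ∃ n, P n := ⟨r, hN⟩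
  -- For the least such `n`, some `n`-minor is nonzero; for `n = 0` it is the empty determinant,
  -- equal to 1.
  obtain ⟨n, hn, hmin⟩ : ∃ n, P n ∧ ∀ m < n, ¬ P m :=
    ⟨Nat.find hP, Nat.find_spec hP, fun m hm => Nat.find_min hP hm⟩
  have hnr : n ≤ r := by
    by_contra h
    exact hmin r (not_le.1 h) hN
  obtain ⟨a, b, hab⟩ : ∃ (a : Fin n → α) (b : Fin n → β),
      (Matrix.of fun i j => N (a i) (b j)).det ≠ 0 := by
    rcases n with _ | m
    · exact ⟨Fin.elim0, Fin.elim0, by simp⟩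
    · simpa [P] using hmin m (Nat.lt_succ_self m)
  set M : Matrix (Fin n) (Fin n) 𝕜 := Matrix.of fun i j => N (a i) (b j) with hM
  refine ⟨n, hnr, a, b, M⁻¹, fun x y => ?_⟩
  let e : Fin (n + 1) ≃ Fin n ⊕ Unit := (finSumFinEquiv (m := n) (n := 1)).symm.trans
    (Equiv.sumCongr (Equiv.refl _) (Equiv.ofUnique _ _))
  -- Border the invertible minor by row `x` and column `y`: the determinant vanishes, hence so does
  -- the scalar Schur complement, which is the claim.
  have h := hn (Sum.elim a (fun _ => x) ∘ e) (Sum.elim b (fun _ => y) ∘ e)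
  let B : Matrix (Fin n ⊕ Unit) (Fin n ⊕ Unit) 𝕜 :=
    Matrix.fromBlocks M (Matrix.of fun i _ => N (a i) y) (Matrix.of fun _ j => N x (b j))
      (Matrix.of fun _ _ => N x y)
  have hB : (Matrix.of fun i j => N ((Sum.elim a (fun _ => x) ∘ e) i)
      ((Sum.elim b (fun _ => y) ∘ e) j)) = B.submatrix e e := by
    ext i j
    simp only [Matrix.of_apply, Function.comp, Matrix.submatrix_apply, B]
    rcases e i with i | i <;> rcases e j with j | j <;> simp [hM]
  have : Invertible M := Matrix.invertibleOfIsUnitDet M (Ne.isUnit hab)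
  rw [hB, Matrix.det_submatrix_equiv_self, Matrix.det_fromBlocks₁₁] at h
  have h2 := (mul_eq_zero.1 h).resolve_left hab
  rw [Matrix.det_unique, Matrix.sub_apply, sub_eq_zero, Matrix.of_apply] at h2
  rw [h2, Matrix.mul_assoc, Matrix.mul_apply]
  simp only [Matrix.mul_apply, Matrix.of_apply, Finset.mul_sum, mul_assoc,
    Matrix.invOf_eq_nonsing_inv]

end Minors

/-! ### Tucker sets as sums of elementary tensors. -/

section Tucker

variable {𝕜 : Type*} [Field 𝕜] {V W : Type*} [AddCommGroup V] [Module 𝕜 V]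
  [AddCommGroup W] [Module 𝕜 W]

/-- A subspace of dimension `m ≤ r` lies in one of dimension `r`, if the dimension of the space
allows it. -/
theorem Submodule.exists_ge_rank_eq (U : Submodule 𝕜 V) {r : ℕ}
    (hU : Module.rank 𝕜 U ≤ r) (hr : (r : Cardinal) ≤ Module.rank 𝕜 V) :
    ∃ U' : Submodule 𝕜 V, U ≤ U' ∧ Module.rank 𝕜 U' = r := by
  obtain ⟨m, hm⟩ := Cardinal.lt_aleph0.1 (hU.trans_lt Cardinal.natCast_lt_aleph0)
  obtain ⟨C, hC⟩ := U.exists_isCompl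
  have hmr : m ≤ r := by rw [hm] at hU; exact_mod_cast hU
  obtain ⟨d, rfl⟩ := Nat.exists_eq_add_of_le hmr
  have hd : (d : Cardinal) ≤ Module.rank 𝕜 C := by
    have h1 := U.rank_quotient_add_rank
    rw [(Submodule.quotientEquivOfIsCompl U C hC).rank_eq, hm] at h1
    rw [← h1, Nat.cast_add, add_comm] at hr
    exact Cardinal.add_le_add_iff_of_lt_aleph0 Cardinal.natCast_lt_aleph0 |>.1 hr
  obtain ⟨v, hv⟩ := exists_linearIndependent_of_le_rank hd
  have hv' : LinearIndependent 𝕜 (C.subtype ∘ v) := hv.map' _ C.ker_subtype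
  set S := Submodule.span 𝕜 (Set.range (C.subtype ∘ v)) with hS
  have hSC : S ≤ C := Submodule.span_le.2 (by rintro _ ⟨i, rfl⟩; exact (v i).2)
  have hSr : Module.rank 𝕜 S = d := by
    rw [rank_span hv']
    simpa using Cardinal.mk_range_eq_of_injective hv'.injective
  have h := Submodule.rank_sup_add_rank_inf_eq U S
  rw [(hC.disjoint.mono_right hSC).eq_bot, rank_bot, add_zero, hm, hSr] at h
  exact ⟨U ⊔ S, le_sup_left, by rw [h]; push_cast; rfl⟩

variable (𝕜 V W) in
/-- The tensors which are sums of `n` elementary tensors. -/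
def sumElementarySet (n : ℕ) : Set (V ⊗[𝕜] W) :=
  {v | ∃ (x : Fin n → V) (y : Fin n → W), v = ∑ i, x i ⊗ₜ[𝕜] y i}

theorem sumElementarySet_mono {m n : ℕ} (h : m ≤ n) :
    sumElementarySet 𝕜 V W m ⊆ sumElementarySet 𝕜 V W n := by
  obtain ⟨d, rfl⟩ := Nat.exists_eq_add_of_le h
  rintro _ ⟨x, y, rfl⟩
  exact ⟨Fin.append x 0, Fin.append y 0, by simp [Fin.sum_univ_add]⟩

theorem rankOneSet_eq : rankOneSet 𝕜 V W = sumElementarySet 𝕜 V W 1 := by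
  ext v
  constructor
  · rintro ⟨x, y, rfl⟩
    exact ⟨fun _ => x, fun _ => y, by simp⟩
  · rintro ⟨x, y, rfl⟩
    exact ⟨x 0, y 0, by simp⟩

/-- Expand along a basis of whichever subspace has the smaller dimension. -/
theorem tuckerSet_subset (r₁ r₂ : ℕ) :
    tuckerSet 𝕜 V W r₁ r₂ ⊆ sumElementarySet 𝕜 V W (min r₁ r₂) := by
  rintro _ ⟨U₁, U₂, h₁, h₂, w, rfl⟩
  have f₁ : Module.Finite 𝕜 U₁ := Module.finite_of_rank_eq_nat h₁
  have f₂ : Module.Finite 𝕜 U₂ := Module.finite_of_rank_eq_nat h₂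
  let b₁ := Module.finBasisOfFinrankEq 𝕜 U₁ (Module.finrank_eq_of_rank_eq h₁)
  let b₂ := Module.finBasisOfFinrankEq 𝕜 U₂ (Module.finrank_eq_of_rank_eq h₂)
  rcases min_choice r₁ r₂ with h | h <;> rw [h]
  · obtain ⟨c, rfl⟩ := TensorProduct.eq_repr_basis_left b₁ w
    refine ⟨fun i => b₁ i, fun i => c i, ?_⟩
    rw [Finsupp.sum_fintype _ _ (by simp)]
    simp
  · obtain ⟨c, rfl⟩ := TensorProduct.eq_repr_basis_right b₂ w
    refine ⟨fun i => c i, fun i => b₂ i, ?_⟩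
    rw [Finsupp.sum_fintype _ _ (by simp)]
    simp

theorem rank_span_range_le_of_le {n r : ℕ} (h : n ≤ r) (x : Fin n → V) :
    Module.rank 𝕜 (Submodule.span 𝕜 (Set.range x)) ≤ r := by
  refine (rank_span_le _).trans (Cardinal.mk_range_le_lift (f := x) |> fun h' => ?_)
  have : Cardinal.mk (Set.range x) ≤ n := by simpa using h'
  exact this.trans (by exact_mod_cast h)

/-- One member already shows that the factors have dimension at least `r₁` and `r₂`, which is what
enlarging the spans requires. -/
theorem tuckerSet_eq_empty_or (r₁ r₂ : ℕ) :
    tuckerSet 𝕜 V W r₁ r₂ = ∅ ∨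
      tuckerSet 𝕜 V W r₁ r₂ = sumElementarySet 𝕜 V W (min r₁ r₂) := by
  rcases Set.eq_empty_or_nonempty (tuckerSet 𝕜 V W r₁ r₂) with h | ⟨_, U₁, U₂, h₁, h₂, -⟩
  · exact Or.inl h
  refine Or.inr (Set.Subset.antisymm (tuckerSet_subset r₁ r₂) ?_)
  rintro _ ⟨x, y, rfl⟩
  obtain ⟨U, hU, hUr⟩ := Submodule.exists_ge_rank_eq (r := r₁) (Submodule.span 𝕜 (Set.range x))
    (rank_span_range_le_of_le (min_le_left _ _) x) (h₁ ▸ U₁.rank_le)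
  obtain ⟨U', hU', hUr'⟩ := Submodule.exists_ge_rank_eq (r := r₂)
    (Submodule.span 𝕜 (Set.range y))
    (rank_span_range_le_of_le (min_le_right _ _) y) (h₂ ▸ U₂.rank_le)
  refine ⟨U, U', hUr, hUr', Submodule.sum_mem _ fun i _ => ?_⟩
  exact ⟨⟨x i, hU (Submodule.subset_span ⟨i, rfl⟩)⟩ ⊗ₜ ⟨y i, hU' (Submodule.subset_span ⟨i, rfl⟩)⟩,
    by simp⟩

end Tucker

/-! ### Weak closedness from determinantal equations. -/

section WeaklyClosed

variable {𝕜 : Type*} [RCLike 𝕜] {E : Type*} [NormedAddCommGroup E] [NormedSpace 𝕜 E]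

theorem isWeaklyClosed_empty : IsWeaklyClosed 𝕜 (∅ : Set E) :=
  ⟨by simp, fun _ _ h _ => h 0⟩

theorem IsWeaklyClosed.iInter {ι : Sort*} {M : ι → Set E} (h : ∀ i, IsWeaklyClosed 𝕜 (M i)) :
    IsWeaklyClosed 𝕜 (⋂ i, M i) := by
  refine ⟨?_, fun u v hu hv => Set.mem_iInter.2 fun i =>
    (h i).2 u v (fun m => Set.mem_iInter.1 (hu m) i) hv⟩
  rw [Set.image_iInter (toWeakSpace 𝕜 E).bijective]
  exact isClosed_iInter fun i => (h i).1

/-- The common zeros of the minors of a matrix of continuous linear functionals form a weakly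
closed set. -/
theorem isWeaklyClosed_setOf_det_eq_zero {n : Type*} [Fintype n] [DecidableEq n]
    (L : n → n → E →L[𝕜] 𝕜) :
    IsWeaklyClosed 𝕜 {v : E | (Matrix.of fun i j => L i j v).det = 0} := by
  constructor
  · have hc : Continuous fun w : WeakSpace 𝕜 E =>
        (Matrix.of fun i j => L i j ((toWeakSpace 𝕜 E).symm w)).det := by
      refine Continuous.matrix_det (continuous_matrix fun i j => ?_)
      exact WeakBilin.eval_continuous (topDualPairing 𝕜 E).flip (L i j)
    have he : toWeakSpace 𝕜 E '' {v : E | (Matrix.of fun i j => L i j v).det = 0} =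
        {w | (Matrix.of fun i j => L i j ((toWeakSpace 𝕜 E).symm w)).det = 0} :=
      (toWeakSpace 𝕜 E).toEquiv.image_eq_preimage_symm _
    rw [he]
    exact isClosed_eq hc continuous_const
  · intro u v hu hv
    have h1 : Tendsto (fun m => Matrix.of fun i j => L i j (u m)) atTop
        (𝓝 (Matrix.of fun i j => L i j v)) :=
      tendsto_pi_nhds.2 fun i => tendsto_pi_nhds.2 fun j => hv (L i j)
    have h2 := ((continuous_id.matrix_det).tendsto (Matrix.of fun i j => L i j v)).comp h1
    refine tendsto_nhds_unique h2 ?_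
    have h3 : (fun A : Matrix n n 𝕜 => (id A).det) ∘ (fun m => Matrix.of fun i j => L i j (u m)) =
        fun _ => (0 : 𝕜) := funext hu
    rw [h3]
    exact tendsto_const_nhds

/-- Let `T` map a tensor product into `E`, and let `L x y` be functionals on `E` which split along
elementary tensors. If every array of rank at most `n` comes from a sum of at most `n` elementary
tensors, then the images of these sums form a weakly closed set. -/
theorem isWeaklyClosed_image_sumElementarySet {V W : Type*} [AddCommGroup V] [Module 𝕜 V]
    [AddCommGroup W] [Module 𝕜 W] (T : V ⊗[𝕜] W →ₗ[𝕜] E) {α β : Type*} (L : α → β → E →L[𝕜] 𝕜)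
    (p : α → V → 𝕜) (q : β → W → 𝕜) (hL : ∀ a b x y, L a b (T (x ⊗ₜ y)) = p a x * q b y)
    (hT : ∀ (F : E) (n : ℕ) (a : Fin n → α) (b : Fin n → β) (C : Matrix (Fin n) (Fin n) 𝕜),
      (∀ x y, L x y F = ∑ j, ∑ i, L x (b j) F * C j i * L (a i) y F) →
      F ∈ T '' sumElementarySet 𝕜 V W n) (r : ℕ) :
    IsWeaklyClosed 𝕜 (T '' sumElementarySet 𝕜 V W r) := by
  have h : T '' sumElementarySet 𝕜 V W r = ⋂ ab : (Fin (r + 1) → α) × (Fin (r + 1) → β),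
      {F | (Matrix.of fun i j => L (ab.1 i) (ab.2 j) F).det = 0} := by
    ext F
    simp only [Set.mem_iInter, Set.mem_ofPred_eq, Prod.forall]
    constructor
    · rintro ⟨_, ⟨x, y, rfl⟩, rfl⟩ a b
      -- The tested array factors through `r` inner indices.
      have : (Matrix.of fun i j => L (a i) (b j) (T (∑ k, x k ⊗ₜ[𝕜] y k))) =
          (Matrix.of fun i k => p (a i) (x k)) * (Matrix.of fun k j => q (b j) (y k)) := by
        ext i j
        simp [Matrix.mul_apply, hL]
      rw [this]
      exact Matrix.det_mul_eq_zero_of_card_lt _ _ (by simp)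
    · intro hF
      obtain ⟨n, hn, a, b, C, h⟩ := exists_skeleton_decomposition (fun x y => L x y F) r hF
      exact Set.image_mono (sumElementarySet_mono hn) (hT F n a b C h)
  rw [h]
  exact IsWeaklyClosed.iInter fun ab => isWeaklyClosed_setOf_det_eq_zero fun i j =>
    L (ab.1 i) (ab.2 j)

theorem isWeaklyClosed_image_tuckerSet {V W : Type*} [AddCommGroup V] [Module 𝕜 V]
    [AddCommGroup W] [Module 𝕜 W] (T : V ⊗[𝕜] W →ₗ[𝕜] E)
    (hT : ∀ n, IsWeaklyClosed 𝕜 (T '' sumElementarySet 𝕜 V W n)) (r₁ r₂ : ℕ) :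
    IsWeaklyClosed 𝕜 (T '' tuckerSet 𝕜 V W r₁ r₂) := by
  rcases tuckerSet_eq_empty_or (𝕜 := 𝕜) (V := V) (W := W) r₁ r₂ with h | h <;> rw [h]
  · simpa using isWeaklyClosed_empty
  · exact hT _

end WeaklyClosed

/-! ### Set integrals as separating functionals; the Bochner case. -/

section SetIntegral

variable {𝕜 : Type*} [RCLike 𝕜] {p : ℝ≥0∞} [hp1 : Fact (1 ≤ p)]
  {I : Type*} [MeasurableSpace I] {μ : Measure I} [IsFiniteMeasure μ]
  {X : Type*} [NormedAddCommGroup X]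

theorem Lp.integrable_of_isFiniteMeasure (F : Lp X p μ) : Integrable F μ :=
  (Lp.memLp F).integrable hp1.out

variable [NormedSpace 𝕜 X] [NormedSpace ℝ X]

/-- Hölder's inequality against the constant 1. -/
theorem Lp.norm_setIntegral_le (F : Lp X p μ) (A : Set I) :
    ‖∫ t in A, F t ∂μ‖ ≤ (μ Set.univ ^ (1 - 1 / p.toReal)).toReal * ‖F‖ := by
  have hF := Lp.integrable_of_isFiniteMeasure F
  have hc : 0 ≤ 1 - 1 / p.toReal := by
    -- For `p = ∞` the conventions `∞.toReal = 0` and `1 / 0 = 0` give the correct exponent 1.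
    rcases eq_or_ne p ∞ with rfl | ht
    · simp
    · have h1 : 1 ≤ p.toReal := by
        simpa using ENNReal.toReal_mono ht hp1.out
      rw [sub_nonneg, div_le_one (by linarith)]
      exact h1
  have hfin : μ Set.univ ^ (1 - 1 / p.toReal) ≠ ∞ :=
    ENNReal.rpow_ne_top_of_nonneg hc (measure_ne_top _ _)
  calc ‖∫ t in A, F t ∂μ‖ ≤ ∫ t in A, ‖F t‖ ∂μ := norm_integral_le_integral_norm _
    _ ≤ ∫ t, ‖F t‖ ∂μ :=
      setIntegral_le_integral hF.norm (ae_of_all _ fun t => norm_nonneg _)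
    _ = (eLpNorm F 1 μ).toReal := by
      rw [integral_norm_eq_lintegral_enorm hF.1, eLpNorm_one_eq_lintegral_enorm]
    _ ≤ (eLpNorm F p μ * μ Set.univ ^ (1 - 1 / p.toReal)).toReal := by
      refine ENNReal.toReal_mono (ENNReal.mul_ne_top (Lp.eLpNorm_ne_top F) hfin) ?_
      simpa using eLpNorm_le_eLpNorm_mul_rpow_measure_univ hp1.out hF.1
    _ = (μ Set.univ ^ (1 - 1 / p.toReal)).toReal * ‖F‖ := by
      rw [ENNReal.toReal_mul, mul_comm, Lp.norm_def]

variable (𝕜) in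
/-- Integration over a set, as a continuous linear map on `L^p` of a finite measure. -/
noncomputable def setIntegralLp [SMulCommClass ℝ 𝕜 X] (A : Set I) : Lp X p μ →L[𝕜] X :=
  LinearMap.mkContinuous
    { toFun := fun F => ∫ t in A, F t ∂μ
      map_add' := fun F G => by
        rw [← integral_add (Lp.integrable_of_isFiniteMeasure F).integrableOn
          (Lp.integrable_of_isFiniteMeasure G).integrableOn]
        exact integral_congr_ae (ae_restrict_of_ae (Lp.coeFn_add F G))
      map_smul' := fun c F => by
        rw [RingHom.id_apply, ← integral_smul]
        exact integral_congr_ae (ae_restrict_of_ae (Lp.coeFn_smul c F)) }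
    (μ Set.univ ^ (1 - 1 / p.toReal)).toReal (fun F => Lp.norm_setIntegral_le F A)

theorem setIntegralLp_apply [SMulCommClass ℝ 𝕜 X] (A : Set I) (F : Lp X p μ) :
    setIntegralLp 𝕜 A F = ∫ t in A, F t ∂μ := rfl

theorem Lp.ext_of_setIntegralLp_eq [SMulCommClass ℝ 𝕜 X] [CompleteSpace X] {F G : Lp X p μ}
    (h : ∀ A, MeasurableSet A → setIntegralLp 𝕜 A F = setIntegralLp 𝕜 A G) : F = G :=
  Lp.ext (Integrable.ae_eq_of_forall_setIntegral_eq _ _ (Lp.integrable_of_isFiniteMeasure F)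
    (Lp.integrable_of_isFiniteMeasure G) fun A hA _ => h A hA)

theorem setIntegralLp_compLp [SMulCommClass ℝ 𝕜 X] [CompleteSpace X] (φ : X →L[𝕜] 𝕜) (A : Set I)
    (F : Lp X p μ) : setIntegralLp 𝕜 A (φ.compLp F) = φ (setIntegralLp 𝕜 A F) := by
  rw [setIntegralLp_apply, setIntegralLp_apply,
    ← φ.integral_comp_comm (Lp.integrable_of_isFiniteMeasure F).integrableOn]
  exact integral_congr_ae (ae_restrict_of_ae (φ.coeFn_compLp F))

theorem setIntegralLp_tensorToBochner_tmul [IsScalarTower ℝ 𝕜 X] [SMulCommClass ℝ 𝕜 X]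
    [CompleteSpace X] (A : Set I) (x : X) (f : Lp 𝕜 p μ) :
    setIntegralLp 𝕜 A (tensorToBochner 𝕜 p X μ (x ⊗ₜ f)) = setIntegralLp 𝕜 A f • x := by
  rw [setIntegralLp_apply, setIntegralLp_apply, ← integral_smul_const]
  exact integral_congr_ae (ae_restrict_of_ae (tensorToBochner_tmul 𝕜 p X μ x f))

end SetIntegral

theorem isWeaklyClosed_tensorToBochner_image {𝕜 : Type*} [RCLike 𝕜] {p : ℝ≥0∞} [Fact (1 ≤ p)]
    {I : Type*} [MeasurableSpace I] (μ : Measure I) [IsFiniteMeasure μ]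
    (X : Type*) [NormedAddCommGroup X] [NormedSpace 𝕜 X] [CompleteSpace X] (r : ℕ) :
    IsWeaklyClosed 𝕜 (tensorToBochner 𝕜 p X μ '' sumElementarySet 𝕜 X (Lp 𝕜 p μ) r) := by
  let _ : NormedSpace ℝ X := NormedSpace.restrictScalars ℝ 𝕜 X
  have : IsScalarTower ℝ 𝕜 X := RestrictScalars.isScalarTower ℝ 𝕜 X
  have : SMulCommClass ℝ 𝕜 X := IsScalarTower.to_smulCommClass
  refine isWeaklyClosed_image_sumElementarySet (tensorToBochner 𝕜 p X μ)
    (fun (φ : X →L[𝕜] 𝕜) (A : {A : Set I // MeasurableSet A}) => φ.comp (setIntegralLp 𝕜 A.1))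
    (fun φ x => φ x) (fun A f => setIntegralLp 𝕜 A.1 f) (fun φ A x f => ?_)
    (fun F n a b C h => ?_) r
  · simp [setIntegralLp_tensorToBochner_tmul, mul_comm]
  -- Columns of the skeleton are the vectors `∫_{b j} F` in `X`; rows are the scalar functions `a i
  -- ∘ F`.
  · refine ⟨_, ⟨fun j => setIntegralLp 𝕜 (b j).1 F, fun j => ∑ i, C j i • (a i).compLp F, rfl⟩, ?_⟩
    refine Lp.ext_of_setIntegralLp_eq (𝕜 := 𝕜) fun A hA => ?_
    refine (SeparatingDual.eq_iff_forall_dual_eq (R := 𝕜)).2 fun φ => ?_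
    have h' := h φ ⟨A, hA⟩
    simp only [ContinuousLinearMap.comp_apply] at h'
    rw [h']
    simp only [map_sum, setIntegralLp_tensorToBochner_tmul, map_smul, setIntegralLp_compLp,
      smul_eq_mul, Finset.sum_mul]
    refine Finset.sum_congr rfl fun j _ => Finset.sum_congr rfl fun i _ => ?_
    ring

/-! ### Marginals and the product case. -/

section Product

variable {𝕜 : Type*} [RCLike 𝕜] {p : ℝ≥0∞} [hp1 : Fact (1 ≤ p)]
  {K I : Type*} [MeasurableSpace K] [MeasurableSpace I]
  {ν : Measure K} {μ : Measure I} [IsFiniteMeasure μ]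

/-- Hölder on each fibre, raised to the power `p`, then Tonelli. -/
theorem MeasureTheory.MemLp.integral_prod_left [SFinite ν] (hp : p ≠ ∞) {E : Type*}
    [NormedAddCommGroup E] [NormedSpace ℝ E] {F : K × I → E} (hF : MemLp F p (ν.prod μ)) :
    MemLp (fun x => ∫ t, F (x, t) ∂μ) p ν := by
  have hp0 : p ≠ 0 := (zero_lt_one.trans_le hp1.out).ne'
  have h1 : 1 ≤ p.toReal := by simpa using ENNReal.toReal_mono hp hp1.out
  have hc : 0 ≤ 1 - 1 / p.toReal := by
    rw [sub_nonneg, div_le_one (by linarith)]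
    exact h1
  refine ⟨hF.1.integral_prod_right', ?_⟩
  have hF2 := lintegral_rpow_enorm_lt_top_of_eLpNorm_lt_top hp0 hp hF.2
  rw [lintegral_prod _ (hF.1.enorm.pow_const _)] at hF2
  rw [eLpNorm_lt_top_iff_lintegral_rpow_enorm_lt_top hp0 hp]
  set c : ℝ≥0∞ := (μ Set.univ ^ (1 - 1 / p.toReal)) ^ p.toReal with hcdef
  have hcfin : c ≠ ∞ := ENNReal.rpow_ne_top_of_nonneg (by linarith)
    (ENNReal.rpow_ne_top_of_nonneg hc (measure_ne_top _ _))
  have hle : ∀ᵐ x ∂ν, ‖∫ t, F (x, t) ∂μ‖ₑ ^ p.toReal ≤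
      (∫⁻ t, ‖F (x, t)‖ₑ ^ p.toReal ∂μ) * c := by
    filter_upwards [hF.1.prodMk_left] with x hx
    have h2 := eLpNorm_le_eLpNorm_mul_rpow_measure_univ hp1.out hx
    rw [eLpNorm_one_eq_lintegral_enorm, ENNReal.toReal_one, div_one,
      eLpNorm_eq_lintegral_rpow_enorm_toReal hp0 hp] at h2
    have h3 := ENNReal.rpow_le_rpow ((enorm_integral_le_lintegral_enorm _).trans h2)
      (zero_le_one.trans h1)
    rwa [ENNReal.mul_rpow_of_nonneg _ _ (zero_le_one.trans h1), ← ENNReal.rpow_mul,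
      one_div_mul_cancel (by linarith), ENNReal.rpow_one] at h3
  refine (lintegral_mono_ae hle).trans_lt ?_
  rw [lintegral_mul_const' _ _ hcfin]
  exact ENNReal.mul_lt_top hF2 hcfin.lt_top

variable [IsFiniteMeasure ν]

/-- Rectangles form a π-system generating the product σ-algebra; the whole space, itself a
rectangle, handles complements. -/
theorem MeasureTheory.Integrable.ae_eq_zero_of_forall_setIntegral_prod_eq_zero {E : Type*}
    [NormedAddCommGroup E] [NormedSpace ℝ E] [CompleteSpace E] {H : K × I → E}
    (hH : Integrable H (ν.prod μ))
    (h : ∀ B A, MeasurableSet B → MeasurableSet A → ∫ z in B ×ˢ A, H z ∂ν.prod μ = 0) :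
    H =ᵐ[ν.prod μ] 0 := by
  refine hH.ae_eq_zero_of_forall_setIntegral_eq_zero fun S hS _ => ?_
  induction S, hS using MeasurableSpace.induction_on_inter generateFrom_prod.symm isPiSystem_prod
    with
  | empty => simp
  | basic t ht =>
    obtain ⟨B, hB, A, hA, rfl⟩ := ht
    exact h B A hB hA
  | compl t ht ih =>
    have h1 := integral_add_compl ht hH
    have h2 := h Set.univ Set.univ .univ .univ
    rw [Set.univ_prod_univ, Measure.restrict_univ] at h2
    rw [ih (measure_lt_top _ _), zero_add, h2] at h1
    exact h1
  | iUnion f hd hf ih =>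
    rw [integral_iUnion hf hd hH.integrableOn]
    simp [fun i => ih i (measure_lt_top _ _)]

theorem Lp.ext_of_setIntegralLp_prod_eq {F G : Lp 𝕜 p (ν.prod μ)}
    (h : ∀ B A, MeasurableSet B → MeasurableSet A →
      setIntegralLp 𝕜 (B ×ˢ A) F = setIntegralLp 𝕜 (B ×ˢ A) G) : F = G := by
  rw [← sub_eq_zero]
  refine Lp.ext ((Integrable.ae_eq_zero_of_forall_setIntegral_prod_eq_zero
    (Lp.integrable_of_isFiniteMeasure _) fun B A hB hA => ?_).trans (Lp.coeFn_zero 𝕜 p _).symm)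
  rw [← setIntegralLp_apply (𝕜 := 𝕜), map_sub, h B A hB hA, sub_self]

theorem setIntegralLp_tensorToLpProd_tmul (B : Set K) (A : Set I) (f : Lp 𝕜 p ν)
    (g : Lp 𝕜 p μ) :
    setIntegralLp 𝕜 (B ×ˢ A) (tensorToLpProd 𝕜 p ν μ (f ⊗ₜ g)) =
      setIntegralLp 𝕜 B f * setIntegralLp 𝕜 A g := by
  simp only [setIntegralLp_apply]
  rw [← setIntegral_prod_mul]
  exact integral_congr_ae (ae_restrict_of_ae (tensorToLpProd_tmul 𝕜 p ν μ f g))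

/-- The function `x ↦ ∫_A F (x, t)` realises a column of the array as an element of `L^p(ν)`. -/
theorem Lp.exists_marginal_fst (hp : p ≠ ∞) (F : Lp 𝕜 p (ν.prod μ)) {A : Set I}
    (hA : MeasurableSet A) :
    ∃ f : Lp 𝕜 p ν, ∀ B, MeasurableSet B →
      setIntegralLp 𝕜 B f = setIntegralLp 𝕜 (B ×ˢ A) F := by
  -- Cutting off by an indicator turns the integral over `A` into a full fibre integral.
  have hm := ((Lp.memLp F).indicator (MeasurableSet.univ.prod hA)).integral_prod_left hp
  refine ⟨hm.toLp _, fun B hB => ?_⟩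
  rw [setIntegralLp_apply, setIntegralLp_apply,
    setIntegral_prod _ (Lp.integrable_of_isFiniteMeasure F).integrableOn]
  refine integral_congr_ae (ae_restrict_of_ae (hm.coeFn_toLp.trans (ae_of_all _ fun x => ?_)))
  dsimp only
  rw [← integral_indicator hA]
  refine integral_congr_ae (ae_of_all _ fun t => ?_)
  dsimp only
  by_cases ht : t ∈ A
  · rw [Set.indicator_of_mem ht, Set.indicator_of_mem (Set.mk_mem_prod (Set.mem_univ x) ht)]
  · rw [Set.indicator_of_notMem ht, Set.indicator_of_notMem fun h => ht (Set.mem_prod.1 h).2]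

theorem Lp.exists_marginal_snd (hp : p ≠ ∞) (F : Lp 𝕜 p (ν.prod μ)) {B : Set K}
    (hB : MeasurableSet B) :
    ∃ g : Lp 𝕜 p μ, ∀ A, MeasurableSet A →
      setIntegralLp 𝕜 A g = setIntegralLp 𝕜 (B ×ˢ A) F := by
  have hs : MeasurePreserving Prod.swap (μ.prod ν) (ν.prod μ) := Measure.measurePreserving_swap
  obtain ⟨g, hg⟩ := Lp.exists_marginal_fst hp (Lp.compMeasurePreserving Prod.swap hs F) hB
  refine ⟨g, fun A hA => ?_⟩
  rw [hg A hA, setIntegralLp_apply, setIntegralLp_apply, ← setIntegral_prod_swap B A F]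
  exact integral_congr_ae (ae_restrict_of_ae (Lp.coeFn_compMeasurePreserving F hs))

variable (ν μ) in
theorem isWeaklyClosed_tensorToLpProd_image (hp : p ≠ ∞) (r : ℕ) :
    IsWeaklyClosed 𝕜
      (tensorToLpProd 𝕜 p ν μ '' sumElementarySet 𝕜 (Lp 𝕜 p ν) (Lp 𝕜 p μ) r) := by
  refine isWeaklyClosed_image_sumElementarySet (tensorToLpProd 𝕜 p ν μ)
    (fun (B : {B : Set K // MeasurableSet B}) (A : {A : Set I // MeasurableSet A}) =>
      setIntegralLp 𝕜 (B.1 ×ˢ A.1))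
    (fun B f => setIntegralLp 𝕜 B.1 f) (fun A g => setIntegralLp 𝕜 A.1 g)
    (fun B A f g => setIntegralLp_tensorToLpProd_tmul B.1 A.1 f g) (fun F n a b C h => ?_) r
  choose f hf using fun j => Lp.exists_marginal_fst hp F (b j).2
  choose g hg using fun i => Lp.exists_marginal_snd hp F (a i).2
  -- The marginals over `b j` and `a i` are the columns and rows of the skeleton.
  refine ⟨_, ⟨f, fun j => ∑ i, C j i • g i, rfl⟩, ?_⟩
  refine Lp.ext_of_setIntegralLp_prod_eq fun B A hB hA => ?_
  rw [h ⟨B, hB⟩ ⟨A, hA⟩]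
  simp only [map_sum, setIntegralLp_tensorToLpProd_tmul, map_smul, hf _ B hB, hg _ A hA,
    smul_eq_mul, Finset.mul_sum, mul_assoc]

end Product

theorem mainTheorem5 {𝕜 : Type*} [RCLike 𝕜] (p : ℝ≥0∞) [Fact (1 ≤ p)] (hp : p ≠ ∞)
    {s : ℕ} (I : Set (EuclideanSpace ℝ (Fin s))) (μ : Measure I) [IsFiniteMeasure μ] :
    (∀ (X : Type*) [NormedAddCommGroup X] [NormedSpace 𝕜 X] [CompleteSpace X] (r₁ r₂ : ℕ),
      IsWeaklyClosed 𝕜 (tensorToBochner 𝕜 p X μ '' tuckerSet 𝕜 X (Lp 𝕜 p μ) r₁ r₂)) ∧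
    (∀ (k : ℕ) (K : Set (EuclideanSpace ℝ (Fin k))) (ν : Measure K) [IsFiniteMeasure ν],
      (∀ r₁ r₂ : ℕ,
        IsWeaklyClosed 𝕜
          (tensorToLpProd 𝕜 p ν μ '' tuckerSet 𝕜 (Lp 𝕜 p ν) (Lp 𝕜 p μ) r₁ r₂)) ∧
      IsWeaklyClosed 𝕜 (tensorToLpProd 𝕜 p ν μ '' rankOneSet 𝕜 (Lp 𝕜 p ν) (Lp 𝕜 p μ))) := by
  refine ⟨fun X _ _ _ => ?_, fun k K ν _ => ⟨?_, ?_⟩⟩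
  · exact isWeaklyClosed_image_tuckerSet _ (isWeaklyClosed_tensorToBochner_image μ X)
  · exact isWeaklyClosed_image_tuckerSet _ (isWeaklyClosed_tensorToLpProd_image ν μ hp)
  · rw [rankOneSet_eq]
    exact isWeaklyClosed_tensorToLpProd_image ν μ hp 1
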